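/- Rings are associative and need not have a unit. A \emph{profinite ring} (regarded as a profinite structure) is a compact Hausdorff topological ring $R$ with a distinguished countable basis $\mathcal B$ of open neighbourhoods of $0$ consisting of clopen ideals, together with a structural group $\mathrm{Aut}^*(R)$, that is, a closed subgroup of the group of all ring automorphisms of $R$ which fix setwise every ideal in $\mathcal B$. It is \emph{small} if for every $n$ the group $\mathrm{Aut}^*(R)$ has only countably many orbits on $R^n$. For $A\subseteq R$ and $a\in R$ let $o(a/A)$ be the orbit of $a$ under the pointwise stabilizer of $A$ in $\mathrm{Aut}^*(R)$. An element $g\in R$ is \emph{generic} if $o(g/\emptyset)$ is open in $R$. A tuple $(g_1,\dots,g_n)$ is \emph{independent} if for each $i$ the orbit $o(g_i/\{g_1,\dots,g_{i-1}\})$ is open in $o(g_i/\emptyset)$. The ring $R$ is \emph{nilpotent} if for some $m\ge 1$ all products of $m$ elements of $R$ are $0$; it is \emph{nil of nilexponent} $m$ if $x^m=0$ for all $x\in R$ and $m$ is the least positive integer with this property. Write $\mathrm{ann}(a)=\{x\in R: xa=ax=0\}$. \textbf{Proposition.} Let $p$ be a prime number and let $R$ be a non-nilpotent, commutative, small profinite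 ring of characteristic $p$ which is nil of nilexponent $p$. (1) For every generic $g\in R$ and every $j\in\{1,\dots,p-1\}$ we have $g^j\neq 0$. (2) Assume additionally that $R/\mathrm{ann}(a)$ is non-nilpotent for every $a\in R\setminus\{0\}$. Then for every $n$, every polynomial $f\in\mathbb F_p[x_1,\dots,x_n]\setminus\{0\}$ with $\deg_{x_1}(f),\dots,\deg_{x_n}(f)<p$, and every independent tuple $(g_1,\dots,g_n)$ of generics of $R$, we have $f(g_1,\dots,g_n)\neq 0$, where the value is computed in the ring $\mathbb F_p\oplus R$ obtained from $R$ by adjoining a unit (it lies in $R$ when $f$ has zero constant term). -/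

import Mathlib

/-! ### Rings without unit -/

/-- The power `x ^ n` of an element of a ring that need not have a unit vanishes. The power is
computed in the ring `ℤ ⊕ R` obtained by adjoining a unit, so that `x ^ 0 = 1` is never zero and
`x ^ n` for `1 ≤ n` is the usual power in `R`. -/
def PowEqZero {R : Type*} [NonUnitalRing R] (x : R) (n : ℕ) : Prop :=
  (x : Unitization ℤ R) ^ n = 0

/-- `x` is nilpotent of nilexponent `n`. -/
def HasNilexponent {R : Type*} [NonUnitalRing R] (x : R) (n : ℕ) : Prop :=
  IsLeast {m : ℕ | PowEqZero x m} n

/-- `R` is nil of nilexponent `n`: every element is nilpotent of nilexponent at most `n`, and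
some element has nilexponent exactly `n`. -/
def IsNilOfNilexponent (R : Type*) [NonUnitalRing R] (n : ℕ) : Prop :=
  (∀ x : R, ∃ m ≤ n, HasNilexponent x m) ∧ ∃ x : R, HasNilexponent x n

/-- `R` is nilpotent: for some `n`, all products `r₁ ⋯ rₙ` of `n` elements of `R` are zero.
(Products are computed in `ℤ ⊕ R`; `n = 0` is impossible because the empty product is `1`.) -/
def IsNilpotentRing (R : Type*) [NonUnitalRing R] : Prop :=
  ∃ n : ℕ, ∀ l : List R, l.length = n →
    (l.map (fun r => (r : Unitization ℤ R))).prod = 0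

/-- The characteristic of `R` is the positive number `n`: it is the least positive integer that
annihilates the additive group of `R`. -/
def HasCharacteristic (R : Type*) [NonUnitalRing R] (n : ℕ) : Prop :=
  IsLeast {m : ℕ | 0 < m ∧ ∀ x : R, m • x = 0} n

/-- The annihilator of `a`, an ideal of the commutative ring `R`. -/
def annIdeal {R : Type*} [NonUnitalCommRing R] (a : R) : TwoSidedIdeal R :=
  TwoSidedIdeal.mk' {x : R | x * a = 0 ∧ a * x = 0}
    (by simp)
    (by rintro x y ⟨h₁, h₂⟩ ⟨h₃, h₄⟩; exact ⟨by simp [add_mul, h₁, h₃], by simp [mul_add, h₂, h₄]⟩)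
    (by rintro x ⟨h₁, h₂⟩; exact ⟨by simp [h₁], by simp [h₂]⟩)
    (by
      rintro x y ⟨h₁, h₂⟩
      exact ⟨by rw [mul_assoc, h₁, mul_zero], by rw [mul_left_comm, h₂, mul_zero]⟩)
    (by
      rintro x y ⟨h₁, h₂⟩
      exact ⟨by rw [mul_right_comm, h₁, zero_mul], by rw [← mul_assoc, h₂, zero_mul]⟩)

/-- The quotient ring `R / ann(a)`. -/
abbrev AnnQuotient {R : Type*} [NonUnitalCommRing R] (a : R) : Type _ :=
  (annIdeal a).ringCon.Quotient

/-- The value `f(g₁, …, gₙ)` of a polynomial over `𝔽_p` at a tuple of elements of a commutative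
ring `R` of characteristic `p` without unit. Because `f` may have a constant term, the value is
taken in the `𝔽_p`-algebra `𝔽_p ⊕ R` obtained by adjoining a unit; it lies in `R` when the constant
term is zero. -/
noncomputable def polyValue {R : Type*} [NonUnitalCommRing R] {p : ℕ}
    (hR : HasCharacteristic R p) {n : ℕ} (f : MvPolynomial (Fin n) (ZMod p)) (g : Fin n → R) :
    Unitization (ZMod p) R :=
  letI : Module (ZMod p) R := AddCommGroup.zmodModule hR.1.2
  haveI : IsScalarTower (ZMod p) R R :=
    ⟨fun c x y => ZMod.map_smul (AddMonoidHom.mulRight y) c x⟩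
  haveI : SMulCommClass (ZMod p) R R :=
    ⟨fun c x y => (ZMod.map_smul (AddMonoidHom.mulLeft x) c y).symm⟩
  MvPolynomial.aeval (fun i => (g i : Unitization (ZMod p) R)) f

/-! ### Profinite rings regarded as profinite structures -/

/-- The standard structural group: all ring automorphisms of `R` that fix setwise each ideal in
the given family. -/
def standardStructuralGroup {R : Type*} [NonUnitalRing R] (basis : Set (TwoSidedIdeal R)) :
    Subgroup (RingAut R) where
  carrier := {σ | ∀ I ∈ basis, ∀ x : R, σ x ∈ I ↔ x ∈ I}
  one_mem' := fun _ _ _ => Iff.rfl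
  mul_mem' := fun {σ τ} hσ hτ I hI x => (hσ I hI (τ x)).trans (hτ I hI x)
  inv_mem' := fun {σ} hσ I hI x => by
    have h := hσ I hI (σ⁻¹ x)
    have e : σ (σ⁻¹ x) = x := σ.apply_symm_apply x
    rw [e] at h
    exact h.symm

/-- The structure of a profinite ring on a topological ring `R` (which is to be compact and
Hausdorff): a distinguished countable basis of neighbourhoods of `0` consisting of (automatically
clopen) ideals, together with the structural group, a subgroup of the standard structural group
that is closed in it for the topology of pointwise convergence (which on the standard structural
group is the inverse limit topology). -/
structure ProfiniteRingStructure (R : Type*) [NonUnitalRing R] [TopologicalSpace R] where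
  basis : Set (TwoSidedIdeal R)
  countable_basis : basis.Countable
  hasBasis : (nhds (0 : R)).HasBasis (fun I => I ∈ basis) (fun I => (I : Set R))
  group : Subgroup (RingAut R)
  group_le : group ≤ standardStructuralGroup basis
  group_closed : ∃ C : Set (R → R), IsClosed C ∧
    ∀ σ ∈ standardStructuralGroup basis, σ ∈ group ↔ (fun x => σ x) ∈ C

namespace ProfiniteRingStructure

variable {R : Type*} [NonUnitalRing R] [TopologicalSpace R] (S : ProfiniteRingStructure R)

/-- The orbit over `∅` of an `n`-tuple under the structural group. -/
def tupleOrbit {n : ℕ} (a : Fin n → R) : Set (Fin n → R) :=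
  {b | ∃ σ ∈ S.group, ∀ i, b i = σ (a i)}

/-- Smallness: for every `n` there are only countably many orbits on `n`-tuples. -/
def IsSmall : Prop :=
  ∀ n : ℕ, (Set.range (fun a : Fin n → R => S.tupleOrbit a)).Countable

/-- The orbit `o(a/A)` of `a` under the pointwise stabilizer of `A` in the structural group. -/
def orbitOver (A : Set R) (a : R) : Set R :=
  {b | ∃ σ ∈ S.group, (∀ x ∈ A, σ x = x) ∧ b = σ a}

/-- `g` is generic (over `∅`): its orbit is open in `R`. -/
def IsGeneric (g : R) : Prop := IsOpen (S.orbitOver ∅ g)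

/-- `a` is `m`-independent from `B` over `A`: the orbit `o(a/AB)` is open in `o(a/A)`. -/
def MIndependent (A : Set R) (a : R) (B : Set R) : Prop :=
  ∃ U : Set R, IsOpen U ∧ S.orbitOver (A ∪ B) a = U ∩ S.orbitOver A a

/-- The tuple `(g₁, …, gₙ)` is independent (over `∅`): each `gᵢ` is `m`-independent from its
predecessors. (This is implied by each `gᵢ` being `m`-independent from all the other entries, and
in small structures the two conditions are equivalent.) -/
def IndependentTuple {n : ℕ} (g : Fin n → R) : Prop :=
  ∀ i : Fin n, S.MIndependent ∅ (g i) (g '' {j | j < i})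

end ProfiniteRingStructure

/-! A polynomial relation at an element transfers to its orbit under the automorphisms fixing the
coefficients. For generics and independent tuples this orbit is open, so it contains a coset `b + I`
of an open ideal. Differencing a polynomial of degree `D < p` along `I` multiplies the leading
coefficient `c` by integers at most `D`, which are invertible, so `c` kills `I ^ D`. By compactness
`R` is generated modulo `I` by finitely many nilpotents, hence `c` kills a power of `R`
(`exists_leadingCoeff_mul_eq_zero`). If `c` is a unit, `R` is nilpotent; if `c` is a nonzero element
of `R`, then `R / ann(c)` is. The first case with `X ^ j` gives (1); both cases, with induction on
the number of variables, give (2). -/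

open Polynomial in
/-- If a polynomial of degree at most `D < p` over an `𝔽_p`-algebra vanishes on the coset of an
ideal `J`, then its coefficient of degree `D` annihilates `J ^ D`. -/
theorem Polynomial.coeff_mul_eq_zero_of_eval_add_eq_zero {A : Type*} [CommRing A] {p : ℕ}
    [Fact p.Prime] [Algebra (ZMod p) A] (J : Ideal A) (b : A) (D : ℕ) (hD : D < p) (P : A[X])
    (hP : P.natDegree ≤ D) (h0 : ∀ h ∈ J, P.eval (b + h) = 0) :
    ∀ x ∈ J ^ D, P.coeff D * x = 0 := by
  induction D generalizing P with
  | zero =>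
    intro x _
    have h := h0 0 J.zero_mem
    rw [eq_C_of_natDegree_le_zero hP, eval_C] at h
    rw [h, zero_mul]
  | succ D ih =>
    have key : ∀ h ∈ J, ∀ y ∈ J ^ D, P.coeff (D + 1) * (y * h) = 0 := by
      intro h hh y hy
      -- The difference `P(X + h) - P(X)` still vanishes on `b + J`. Its top term cancels, and its
      -- coefficient of degree `D` is `(D + 1) * c * h`.
      have hdeg : (taylor h P - P).natDegree ≤ D := by
        rw [natDegree_le_iff_coeff_eq_zero]
        intro N hN
        rcases (Nat.succ_le_of_lt hN).eq_or_lt with rfl | hN'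
        · have e := natDegree_hasseDeriv_le P (D + 1)
          rw [coeff_sub, taylor_coeff, eq_C_of_natDegree_le_zero (e.trans (by omega)), eval_C,
            hasseDeriv_coeff]
          simp
        · rw [coeff_sub, coeff_eq_zero_of_natDegree_lt (by rw [natDegree_taylor]; omega),
            coeff_eq_zero_of_natDegree_lt (by omega), sub_zero]
      have hcoeff : (taylor h P - P).coeff D = (D + 1 : ℕ) * P.coeff (D + 1) * h := by
        have e := natDegree_hasseDeriv_le P D
        rw [coeff_sub, taylor_coeff,
          eq_X_add_C_of_natDegree_le_one (p := hasseDeriv D P) (e.trans (by omega)),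
          hasseDeriv_coeff, hasseDeriv_coeff, add_comm 1 D]
        simp
      have h1 := ih (by omega) _ hdeg (fun k hk => by
        rw [eval_sub, taylor_eval, add_assoc, h0 _ hk, h0 _ (J.add_mem hk hh), sub_zero]) y hy
      rw [hcoeff] at h1
      have hne : ((D + 1 : ℕ) : ZMod p) ≠ 0 := by
        rw [Ne, ZMod.natCast_eq_zero_iff]
        exact Nat.not_dvd_of_pos_of_lt D.succ_pos hD
      have hu : IsUnit ((D + 1 : ℕ) : A) := by
        have := (IsUnit.mk0 _ hne).map (algebraMap (ZMod p) A)
        rwa [map_natCast] at this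
      rw [← hu.mul_right_eq_zero, ← h1]
      ring
    intro x hx
    rw [pow_succ] at hx
    induction hx using Submodule.mul_induction_on' with
    | mem_mul_mem y hy h hh => exact key h hh y hy
    | add y _ z _ hy hz => rw [mul_add, hy, hz, add_zero]

/-! ### Products without a unit and their images in unitizations -/

section NonUnital

variable {R : Type*} [NonUnitalCommRing R]

theorem Unitization.prod_map_inr_cons (k : Type*) [CommRing k] [Module k R] [IsScalarTower k R R]
    [SMulCommClass k R R] (x : R) (l : List R) :
    ((x :: l).map (fun r : R => (r : Unitization k R))).prod
      = ((l.foldl (· * ·) x : R) : Unitization k R) := by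
  induction l generalizing x with
  | nil => simp
  | cons y l ih =>
    rw [List.foldl_cons, ← ih (x * y)]
    simp [mul_assoc]

/-- A power with positive exponent is already formed in `R`, which embeds in every unitization. -/
theorem powEqZero_succ_iff (k : Type*) [CommRing k] [Module k R] [IsScalarTower k R R]
    [SMulCommClass k R R] (x : R) (n : ℕ) :
    PowEqZero x (n + 1) ↔ (x : Unitization k R) ^ (n + 1) = 0 := by
  have h := Unitization.prod_map_inr_cons k x (List.replicate n x)
  have h' := Unitization.prod_map_inr_cons ℤ x (List.replicate n x)
  rw [← List.replicate_succ, List.map_replicate, List.prod_replicate] at h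
  rw [← List.replicate_succ, List.map_replicate] at h'
  have e : (x : Unitization ℤ R) ^ (n + 1) = _ := (List.prod_replicate _ _).symm.trans h'
  rw [PowEqZero, h, e, ← Unitization.inr_zero k, ← Unitization.inr_zero ℤ,
    Unitization.inr_injective.eq_iff, Unitization.inr_injective.eq_iff]

theorem isNilpotentRing_of_foldl (n : ℕ)
    (h : ∀ (x : R) (l : List R), l.length = n → l.foldl (· * ·) x = 0) : IsNilpotentRing R := by
  refine ⟨n + 1, fun l hl => ?_⟩
  obtain ⟨x, l, rfl⟩ := List.exists_cons_of_length_eq_add_one hl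
  have e := Unitization.prod_map_inr_cons ℤ x l
  rw [h x l (by simpa using hl), Unitization.inr_zero] at e
  -- In `IsNilpotentRing` the list itself is coerced, through the list monad; this turns it back
  -- into a plain `map`.
  rw [← e, List.map_id', List.bind_eq_flatMap]
  exact congrArg List.prod (List.map_eq_flatMap).symm

theorem isNilpotentRing_annQuotient_of_foldl (a : R) (n : ℕ)
    (h : ∀ (x : R) (l : List R), l.length = n → l.foldl (· * ·) x * a = 0) :
    IsNilpotentRing (AnnQuotient a) := by
  refine isNilpotentRing_of_foldl n fun x l hl => ?_
  have hs : Function.Surjective ((↑) : R → AnnQuotient a) := Quotient.mk''_surjective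
  obtain ⟨x, rfl⟩ := hs x
  obtain ⟨l, rfl⟩ := hs.list_map l
  have e : ∀ (l : List R) (x : R), (l.map ((↑) : R → AnnQuotient a)).foldl (· * ·) (x : AnnQuotient a)
      = ((l.foldl (· * ·) x : R) : AnnQuotient a) := by
    intro l
    induction l with
    | nil => simp
    | cons y l ih => intro x; simpa using ih (x * y)
  rw [e]
  have hm : l.foldl (· * ·) x ∈ annIdeal a := by
    rw [annIdeal, TwoSidedIdeal.mem_mk']
    have := h x l (by simpa using hl)
    exact ⟨this, by rw [mul_comm, this]⟩
  exact (RingCon.eq _).2 hm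

/-! ### Polynomials vanishing on open sets, and powers of the augmentation ideal -/

variable {p : ℕ} [Fact p.Prime] [Module (ZMod p) R] [IsScalarTower (ZMod p) R R]
  [SMulCommClass (ZMod p) R R]

/-- The ideal of `𝔽_p ⊕ R` consisting of the elements of an ideal of `R`. -/
def Unitization.idealOfTwoSided (p : ℕ) [Module (ZMod p) R] [IsScalarTower (ZMod p) R R]
    [SMulCommClass (ZMod p) R R] (I : TwoSidedIdeal R) : Ideal (Unitization (ZMod p) R) where
  carrier := {x | ∃ i ∈ I, x = (i : Unitization (ZMod p) R)}
  zero_mem' := ⟨0, I.zero_mem, by simp⟩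
  add_mem' := by
    rintro _ _ ⟨i, hi, rfl⟩ ⟨j, hj, rfl⟩
    exact ⟨i + j, I.add_mem hi hj, by simp⟩
  smul_mem' := by
    rintro c _ ⟨i, hi, rfl⟩
    refine ⟨c.fst • i + c.snd * i, I.add_mem ?_ (I.mul_mem_left _ _ hi), ?_⟩
    · let K : AddSubgroup R :=
        { carrier := {x | x ∈ I}, zero_mem' := I.zero_mem, add_mem' := I.add_mem,
          neg_mem' := I.neg_mem }
      exact ZMod.smul_mem (K := K) hi c.fst
    · ext <;> simp

/-- If a polynomial of degree less than `p` over `𝔽_p ⊕ R` vanishes on a nonempty open subset of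
`R`, then its leading coefficient annihilates some power of the augmentation ideal. -/
theorem exists_leadingCoeff_mul_eq_zero [TopologicalSpace R] [IsTopologicalRing R] [CompactSpace R]
    (S : ProfiniteRingStructure R) (hnil : ∀ x : R, IsNilpotent (x : Unitization (ZMod p) R))
    {U : Set R} (hU : IsOpen U) {b : R} (hb : b ∈ U)
    (P : Polynomial (Unitization (ZMod p) R)) (hP : P.natDegree < p)
    (h0 : ∀ y ∈ U, P.eval (y : Unitization (ZMod p) R) = 0) :
    ∃ N, ∀ x ∈ Unitization.idealOfTwoSided p (⊤ : TwoSidedIdeal R) ^ N,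
      P.leadingCoeff * x = 0 := by
  have hU' : (fun h => b + h) ⁻¹' U ∈ nhds (0 : R) :=
    (hU.preimage (continuous_const.add continuous_id)).mem_nhds (by simpa using hb)
  obtain ⟨I, hI, hIU⟩ := S.hasBasis.mem_iff.1 hU'
  let K : AddSubgroup R :=
    { carrier := {x | x ∈ I}, zero_mem' := I.zero_mem, add_mem' := I.add_mem,
      neg_mem' := I.neg_mem }
  have hK : IsOpen (K : Set R) := K.isOpen_of_mem_nhds (S.hasBasis.mem_of_mem hI)
  have : Finite (R ⧸ K) := K.quotient_finite_of_isOpen hK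
  -- Representatives of the finitely many cosets of `I`: being nilpotent, they span a nilpotent
  -- ideal.
  let T : Set (Unitization (ZMod p) R) :=
    Set.range fun q : R ⧸ K => ((Quotient.out q : R) : Unitization (ZMod p) R)
  have hT : (Ideal.span T).FG := Submodule.fg_span (Set.finite_range _)
  obtain ⟨N, hN⟩ := hT.isNilpotent_iff_le_nilradical.2 (Ideal.span_le.2 (by
    rintro _ ⟨q, rfl⟩
    exact hnil _))
  set J := Unitization.idealOfTwoSided p I
  have hle : Unitization.idealOfTwoSided p (⊤ : TwoSidedIdeal R) ≤ Ideal.span T ⊔ J := by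
    rintro _ ⟨r, -, rfl⟩
    have hr : -(Quotient.out (r : R ⧸ K) : R) + r ∈ K :=
      QuotientAddGroup.eq.1 (Quotient.out_eq _)
    refine Submodule.mem_sup.2 ⟨_, Ideal.subset_span ⟨(r : R ⧸ K), rfl⟩, _, ⟨_, hr, rfl⟩, ?_⟩
    rw [← Unitization.inr_add, add_neg_cancel_left]
  refine ⟨N + P.natDegree, fun x hx => ?_⟩
  refine Polynomial.coeff_mul_eq_zero_of_eval_add_eq_zero J (b : Unitization (ZMod p) R) _ hP P
    le_rfl ?_ x ?_
  · rintro _ ⟨i, hi, rfl⟩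
    rw [← Unitization.inr_add]
    exact h0 _ (hIU hi)
  -- `(T + J) ^ (N + D) ≤ T ^ N + J ^ D`, and `T ^ N = 0`.
  · have h := Ideal.sup_pow_add_le_pow_sup_pow (Ideal.pow_right_mono hle _ hx)
    rw [hN] at h
    simpa using h

theorem inr_foldl_mem_pow (x : R) (l : List R) :
    ((l.foldl (· * ·) x : R) : Unitization (ZMod p) R) ∈
      Unitization.idealOfTwoSided p (⊤ : TwoSidedIdeal R) ^ l.length := by
  induction l using List.reverseRecOn with
  | nil => simp
  | append_singleton l y ih =>
    rw [List.foldl_append, List.length_append, List.length_singleton, pow_succ]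
    simpa using Ideal.mul_mem_mul ih
      (⟨y, trivial, rfl⟩ : (y : Unitization (ZMod p) R) ∈ Unitization.idealOfTwoSided p ⊤)

theorem isNilpotentRing_of_pow (N : ℕ)
    (h : ∀ x ∈ Unitization.idealOfTwoSided p (⊤ : TwoSidedIdeal R) ^ N, x = 0) :
    IsNilpotentRing R := by
  refine isNilpotentRing_of_foldl N fun x l hl => ?_
  have := h _ (hl ▸ inr_foldl_mem_pow x l)
  rwa [← Unitization.inr_zero, Unitization.inr_inj] at this

theorem isNilpotentRing_annQuotient_of_pow (a : R) (N : ℕ)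
    (h : ∀ x ∈ Unitization.idealOfTwoSided p (⊤ : TwoSidedIdeal R) ^ N,
      (a : Unitization (ZMod p) R) * x = 0) :
    IsNilpotentRing (AnnQuotient a) := by
  refine isNilpotentRing_annQuotient_of_foldl a N fun x l hl => ?_
  have := h _ (hl ▸ inr_foldl_mem_pow x l)
  rwa [← Unitization.inr_mul, ← Unitization.inr_zero, Unitization.inr_inj, mul_comm] at this

/-! ### Values of polynomials at tuples with open orbits -/

theorem isUnit_unitization_of_fst_ne_zero
    (hnil : ∀ x : R, IsNilpotent (x : Unitization (ZMod p) R)) {c : Unitization (ZMod p) R}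
    (hc : c.fst ≠ 0) : IsUnit c := by
  rw [← Unitization.inl_fst_add_inr_snd_eq c]
  exact (hnil _).isUnit_add_left_of_commute
    ((IsUnit.mk0 _ hc).map (Unitization.inlRingHom (ZMod p) R)) (Commute.all _ _)

theorem MvPolynomial.aeval_eq_eval_map_finSuccEquiv {k A : Type*} [CommRing k] [CommRing A]
    [Algebra k A] {n : ℕ} (g : Fin (n + 1) → A) (f : MvPolynomial (Fin (n + 1)) k) :
    aeval g f = Polynomial.eval (g 0)
      ((finSuccEquiv k n f).map (aeval (fun i => g i.succ) : _ →ₐ[k] A).toRingHom) := by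
  induction f using MvPolynomial.induction_on with
  | C a => simp [finSuccEquiv_apply]
  | add f g hf hg => simp [hf, hg]
  | mul_X f i hf =>
    rw [map_mul, hf, map_mul, Polynomial.map_mul, Polynomial.eval_mul]
    congr 1
    refine Fin.cases ?_ (fun j => ?_) i
    · simp [finSuccEquiv_X_zero]
    · simp [finSuccEquiv_X_succ]

/-- An automorphism of `R` extends to `𝔽_p ⊕ R` fixing the scalars, so relations spread along
orbits. -/
theorem aeval_ringEquiv {n : ℕ} (σ : R ≃+* R) (g : Fin n → R)
    (f : MvPolynomial (Fin n) (ZMod p))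
    (h : MvPolynomial.aeval (fun i => (g i : Unitization (ZMod p) R)) f = 0) :
    MvPolynomial.aeval (fun i => (σ (g i) : Unitization (ZMod p) R)) f = 0 := by
  let φ : R →ₙₐ[ZMod p] Unitization (ZMod p) R :=
    (Unitization.inrNonUnitalAlgHom (ZMod p) R).comp
      { toFun := σ
        map_smul' := fun c x => ZMod.map_smul σ c x
        map_zero' := map_zero σ
        map_add' := map_add σ
        map_mul' := map_mul σ }
  have e := congrArg (Unitization.lift φ) h
  rw [map_zero, ← AlgHom.comp_apply, MvPolynomial.comp_aeval] at e
  convert e using 4 with i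
  simp [φ]

/-- Each entry is taken over the later ones because `finSuccEquiv` splits off variable `0`, leaving
coefficients in the others. -/
theorem aeval_ne_zero_of_isOpen_orbitOver [TopologicalSpace R] [IsTopologicalRing R]
    [CompactSpace R] (S : ProfiniteRingStructure R)
    (hnil : ∀ x : R, IsNilpotent (x : Unitization (ZMod p) R)) (hR : ¬ IsNilpotentRing R)
    (hann : ∀ a : R, a ≠ 0 → ¬ IsNilpotentRing (AnnQuotient a)) (n : ℕ)
    (f : MvPolynomial (Fin n) (ZMod p)) (hf : f ≠ 0) (hdeg : ∀ i, f.degreeOf i < p)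
    (g : Fin n → R) (hg : ∀ i, IsOpen (S.orbitOver (g '' {j | i < j}) (g i))) :
    MvPolynomial.aeval (fun i => (g i : Unitization (ZMod p) R)) f ≠ 0 := by
  induction n with
  | zero =>
    obtain ⟨c, rfl⟩ := MvPolynomial.C_surjective (Fin 0) f
    intro h
    rw [MvPolynomial.algHom_C, Unitization.algebraMap_eq_inl] at h
    refine hf ?_
    rw [← Unitization.inl_zero, Unitization.inl_injective.eq_iff] at h
    rw [h, map_zero]
  | succ n ih =>
    intro h
    set P := (MvPolynomial.finSuccEquiv (ZMod p) n f).map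
      (MvPolynomial.aeval (fun i : Fin n => (g i.succ : Unitization (ZMod p) R)) :
        _ →ₐ[ZMod p] _).toRingHom with hPdef
    have hP0 : P ≠ 0 := by
      have hf' : MvPolynomial.finSuccEquiv (ZMod p) n f ≠ 0 := by simpa using hf
      obtain ⟨i, hi⟩ : ∃ i, (MvPolynomial.finSuccEquiv (ZMod p) n f).coeff i ≠ 0 := by
        by_contra! hc
        exact hf' (Polynomial.ext (by simpa using hc))
      -- By induction a nonzero coefficient stays nonzero when evaluated at the remaining entries.
      have := ih _ hi
        (fun j => (MvPolynomial.degreeOf_coeff_finSuccEquiv f j i).trans_lt (hdeg _))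
        (fun i => g i.succ) (fun i => by
          have e : (fun i : Fin n => g i.succ) '' {j | i < j} = g '' {j | i.succ < j} := by
            ext y
            constructor
            · rintro ⟨j, hj, rfl⟩
              exact ⟨j.succ, Fin.succ_lt_succ_iff.2 hj, rfl⟩
            · rintro ⟨j, hj, rfl⟩
              obtain ⟨j, rfl⟩ := Fin.exists_succ_eq.2 (Fin.ne_zero_of_lt hj)
              exact ⟨j, Fin.succ_lt_succ_iff.1 hj, rfl⟩
          rw [e]
          exact hg i.succ)
      intro hP
      apply this
      have := congrArg (fun Q => Q.coeff i) hP
      simpa [hPdef] using this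
    have hPdeg : P.natDegree < p :=
      (Polynomial.natDegree_map_le).trans_lt
        ((MvPolynomial.natDegree_finSuccEquiv f).trans_lt (hdeg 0))
    obtain ⟨N, hN⟩ := exists_leadingCoeff_mul_eq_zero S hnil (hg 0)
      (b := g 0) ⟨1, S.group.one_mem, fun _ _ => rfl, rfl⟩ P hPdeg (by
        rintro y ⟨σ, -, hσ, rfl⟩
        have e := aeval_ringEquiv σ g f h
        rw [MvPolynomial.aeval_eq_eval_map_finSuccEquiv] at e
        have e' : (fun i : Fin n => ((σ (g i.succ) : R) : Unitization (ZMod p) R)) =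
            fun i => (g i.succ : Unitization (ZMod p) R) := by
          funext i
          rw [hσ _ ⟨i.succ, Fin.succ_pos i, rfl⟩]
        rw [e'] at e
        exact e)
    have hc : P.leadingCoeff ≠ 0 := Polynomial.leadingCoeff_ne_zero.2 hP0
    -- Either the leading coefficient lies in `R`, contradicting `hann`, or it is a unit,
    -- contradicting `hR`.
    by_cases hfst : P.leadingCoeff.fst = 0
    · have hc' : P.leadingCoeff = (P.leadingCoeff.snd : Unitization (ZMod p) R) := by
        ext <;> simp [hfst]
      rw [hc'] at hN hc
      exact hann _ (fun h0 => hc (by rw [h0, Unitization.inr_zero]))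
        (isNilpotentRing_annQuotient_of_pow _ N hN)
    · exact hR (isNilpotentRing_of_pow (p := p) N fun x hx =>
        (isUnit_unitization_of_fst_ne_zero hnil hfst).mul_right_eq_zero.1 (hN x hx))

theorem not_powEqZero_of_isGeneric [TopologicalSpace R] [IsTopologicalRing R]
    [CompactSpace R] (S : ProfiniteRingStructure R)
    (hnil : ∀ x : R, IsNilpotent (x : Unitization (ZMod p) R)) (hR : ¬ IsNilpotentRing R)
    {g : R} (hg : S.IsGeneric g) {j : ℕ} (hj : 1 ≤ j) (hjp : j < p) : ¬ PowEqZero g j := by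
  intro h
  have hP : ((Polynomial.X : Polynomial (Unitization (ZMod p) R)) ^ j).natDegree < p :=
    (Polynomial.natDegree_X_pow_le j).trans_lt hjp
  obtain ⟨N, hN⟩ := exists_leadingCoeff_mul_eq_zero S hnil hg (b := g)
    ⟨1, S.group.one_mem, fun _ _ => rfl, rfl⟩ (Polynomial.X ^ j) hP (by
      rintro y ⟨σ, -, -, rfl⟩
      obtain ⟨j, rfl⟩ := Nat.exists_eq_add_of_le' hj
      rw [powEqZero_succ_iff (ZMod p)] at h
      have := aeval_ringEquiv (n := 1) (p := p) σ (fun _ => g) (MvPolynomial.X 0 ^ (j + 1))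
        (by simpa using h)
      simpa using this)
  exact hR (isNilpotentRing_of_pow (p := p) N fun x hx => by simpa using hN x hx)

end NonUnital

theorem mainTheorem5 {R : Type*} [NonUnitalCommRing R] [TopologicalSpace R]
    [IsTopologicalRing R] [CompactSpace R] [T2Space R]
    (S : ProfiniteRingStructure R) (hsmall : S.IsSmall)
    {p : ℕ} (hp : p.Prime) (hchar : HasCharacteristic R p)
    (hnil : IsNilOfNilexponent R p) (hR : ¬ IsNilpotentRing R) :
    (∀ g : R, S.IsGeneric g → ∀ j : ℕ, 1 ≤ j → j < p → ¬ PowEqZero g j) ∧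
    ((∀ a : R, a ≠ 0 → ¬ IsNilpotentRing (AnnQuotient a)) →
      ∀ (n : ℕ) (f : MvPolynomial (Fin n) (ZMod p)), f ≠ 0 → (∀ i, f.degreeOf i < p) →
        ∀ g : Fin n → R, (∀ i, S.IsGeneric (g i)) → S.IndependentTuple g →
          polyValue hchar f g ≠ 0) := by
  have : Fact p.Prime := ⟨hp⟩
  let _ : Module (ZMod p) R := AddCommGroup.zmodModule hchar.1.2
  have : IsScalarTower (ZMod p) R R :=
    ⟨fun c x y => ZMod.map_smul (AddMonoidHom.mulRight y) c x⟩
  have : SMulCommClass (ZMod p) R R :=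
    ⟨fun c x y => (ZMod.map_smul (AddMonoidHom.mulLeft x) c y).symm⟩
  have hnil' : ∀ x : R, IsNilpotent (x : Unitization (ZMod p) R) := by
    intro x
    obtain ⟨m, -, hm, -⟩ := hnil.1 x
    have hm' : PowEqZero x (m + 1) := by
      have h : (x : Unitization ℤ R) ^ m = 0 := hm
      rw [PowEqZero, pow_succ, h, zero_mul]
    exact ⟨m + 1, (powEqZero_succ_iff (ZMod p) x m).1 hm'⟩
  refine ⟨fun g hg j hj hjp => not_powEqZero_of_isGeneric S hnil' hR hg hj hjp,
    fun hann n f hf hdeg g hgen hind => ?_⟩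
  -- Relatively open in the orbit over `∅`, which is itself open by genericity.
  have hopen : ∀ i, IsOpen (S.orbitOver (g '' {j | j < i}) (g i)) := by
    intro i
    obtain ⟨U, hU, e⟩ := hind i
    rw [Set.empty_union] at e
    rw [e]
    exact hU.inter (hgen i)
  -- Independence is over predecessors, the lemma over successors: reverse the variables.
  have hmain := aeval_ne_zero_of_isOpen_orbitOver S hnil' hR hann n
    (MvPolynomial.rename Fin.rev f)
    (by rwa [Ne, (MvPolynomial.rename_injective _ Fin.rev_injective).eq_iff' (map_zero _)])
    (fun i => by
      rw [← Fin.rev_rev i, MvPolynomial.degreeOf_rename_of_injective Fin.rev_injective]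
      exact hdeg _)
    (fun i => g i.rev) (fun i => by
      have e : (fun i : Fin n => g i.rev) '' {j | i < j} = g '' {j | j < i.rev} := by
        ext y
        constructor
        · rintro ⟨j, hj, rfl⟩
          exact ⟨j.rev, Fin.rev_lt_rev.2 hj, rfl⟩
        · rintro ⟨j, hj, rfl⟩
          refine ⟨j.rev, ?_, by simp⟩
          have := Fin.rev_lt_rev.2 (show j < i.rev from hj)
          simpa using this
      rw [e]
      exact hopen i.rev)
  rw [MvPolynomial.aeval_rename] at hmain
  intro h
  refine hmain (Eq.trans ?_ h)
  simp [polyValue, Function.comp_def]
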